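/- All polynomials are in $\mathbb{R}[x]$. A polynomial is called real-rooted if all its complex zeros are real; nonzero constants and the zero polynomial count as real-rooted. Let $f,g$ be nonzero real-rooted polynomials with positive leading coefficients, with zeros $\alpha_1\ge\alpha_2\ge\cdots\ge\alpha_p$ and $\beta_1\ge\beta_2\ge\cdots\ge\beta_q$ respectively, counted with multiplicity. Write $f\ll g$ if $$\cdots\le\alpha_2\le\beta_2\le\alpha_1\le\beta_1,$$ where the alternating chain contains all zeros of both polynomials (so $q\in\{p,p+1\}$). By convention also $f\ll 0$ and $0\ll f$, and $0\ll 0$. Let $\mathcal{F}_n^+$ be the set of all sequences $(f_1,\dots,f_n)$ of real-rooted polynomials with nonnegative coefficients such that $f_i\ll f_j$ for all $1\le i<j\le n$. Let $G=(G_{ij}(x))$ be an $m\times n$ matrix all of whose entries belong to $\{0,1,x\}$, such that: 1. if $G_{ij}=1$, then $G_{kl}=1$ for all $1\le k\le i$ and $j\le l\le n$ (the entries equal to $1$ form a Ferrers board in the top right corner of $G$); 2. if $G_{ij}=x$, then $G_{kl}=x$ for all $i\le k\le m$ and $1\le l\le j$ (the entries equal to $x$ form a Ferrers board in the bottom left corner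 of $G$). Then $G:\mathcal{F}_n^+\to\mathcal{F}_m^+$; that is, for every $(f_1,\dots,f_n)\in\mathcal{F}_n^+$ the sequence $(g_1,\dots,g_m)$ with $g_k=\sum_{i=1}^n G_{ki}f_i$ belongs to $\mathcal{F}_m^+$. -/

import Mathlib

open Polynomial

namespace InterlacingPolynomials

/-- A real polynomial is real-rooted if it splits over `ℝ` (all its complex zeros are real).
The zero polynomial and the nonzero constants count as real-rooted. -/
def RealRooted (f : ℝ[X]) : Prop := f.Splits

/-- The real zeros of `f`, listed in weakly decreasing order and with multiplicity
(the empty list if `f` is zero or a nonzero constant). -/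
noncomputable def zeros (f : ℝ[X]) : List ℝ := f.roots.sort (· ≥ ·)

/-- For decreasing lists `α₁ ≥ α₂ ≥ ⋯` and `β₁ ≥ β₂ ≥ ⋯`, the condition
`⋯ ≤ α₂ ≤ β₂ ≤ α₁ ≤ β₁`. The chain alternates, starts with `β₁` and uses up all the entries of
both lists, so `β` is as long as `α` or has exactly one entry more. -/
def Alternates (α β : List ℝ) : Prop :=
  (β.length = α.length ∨ β.length = α.length + 1) ∧
  (∀ (i : ℕ) (hα : i < α.length) (hβ : i < β.length), α[i] ≤ β[i]) ∧
  (∀ (i : ℕ) (hα : i < α.length) (hβ : i + 1 < β.length), β[i + 1] ≤ α[i])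

/-- `f ≪ g`, that is, `f` is an interleaver of `g`: both are real-rooted with positive leading
coefficients and their zeros alternate as above. Moreover `f ≪ 0` and `0 ≪ f`. -/
def Interleaves (f g : ℝ[X]) : Prop :=
  f = 0 ∨ g = 0 ∨
    (RealRooted f ∧ RealRooted g ∧ 0 < f.leadingCoeff ∧ 0 < g.leadingCoeff ∧
      Alternates (zeros f) (zeros g))

/-- The family `𝓕ₙ` of interlacing sequences: sequences `f₁, …, fₙ` of real-rooted polynomials
with `fᵢ ≪ fⱼ` for all `i < j`. -/
def interlacingFamily (n : ℕ) : Set (Fin n → ℝ[X]) :=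
  {f | (∀ i, RealRooted (f i)) ∧ ∀ i j, i < j → Interleaves (f i) (f j)}

/-- The family `𝓕ₙ⁺` of interlacing sequences all of whose members have nonnegative
coefficients. -/
def nonnegInterlacingFamily (n : ℕ) : Set (Fin n → ℝ[X]) :=
  {f | f ∈ interlacingFamily n ∧ ∀ i k, 0 ≤ (f i).coeff k}

/-- `G : 𝓕ₙ⁺ → 𝓕ₘ⁺`: the map sending `(f₁, …, fₙ)` to `(g₁, …, gₘ)`, `gₖ = ∑ᵢ Gₖᵢ fᵢ`, maps
`𝓕ₙ⁺` into `𝓕ₘ⁺`. -/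
def PreservesInterlacing {m n : ℕ} (G : Matrix (Fin m) (Fin n) ℝ[X]) : Prop :=
  Set.MapsTo (fun f : Fin n → ℝ[X] => G.mulVec f)
    (nonnegInterlacingFamily n) (nonnegInterlacingFamily m)

end InterlacingPolynomials

namespace InterlacingPolynomials

open Real Filter Topology

/-! For nonzero real-rooted `f`, `g` with positive leading coefficients, `f ≪ g` holds iff `g(z) *
conj (f(z))` has nonnegative imaginary part on the upper half-plane
(`Interleaves.im_mul_conj_nonneg`, `interleaves_of_im_nonneg`). This condition is additive in each
polynomial. With nonnegative coefficients, `f ≪ g` also gives `g ≪ X * f`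
(`Interleaves.X_mul_right`).

In each row of `G` the entries `X` precede the `0`s, which precede the `1`s. Real-rootedness of a
row sum follows because, relative to one chosen term, every nonzero term has argument in `[0, π)`,
so nothing cancels (`realRooted_sum_mul`). For two rows, columns are grouped by their pair of
entries and the product is expanded block by block (`im_block_sum_nonneg`). -/

/-- The argument in `(0, π)` of the complex number `t + ε i - b`, for `0 < ε`. -/
noncomputable def rootAngle (ε t b : ℝ) : ℝ := π / 2 - arctan ((t - b) / ε)

/-- The sum of the arguments of the numbers `t + ε i - b` for `b` in `l`. -/
noncomputable def angleSum (ε t : ℝ) (l : List ℝ) : ℝ := (l.map (rootAngle ε t)).sum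

/-! ### Arguments of real-rooted polynomials as sums over the zeros. -/

lemma rootAngle_pos (ε t b : ℝ) : 0 < rootAngle ε t b :=
  sub_pos.2 (arctan_lt_pi_div_two _)

lemma rootAngle_lt_pi (ε t b : ℝ) : rootAngle ε t b < π := by
  have := neg_pi_div_two_lt_arctan ((t - b) / ε)
  unfold rootAngle; linarith

lemma rootAngle_mono {ε : ℝ} (hε : 0 < ε) (t : ℝ) : Monotone (rootAngle ε t) := by
  intro a b hab
  unfold rootAngle
  have : arctan ((t - b) / ε) ≤ arctan ((t - a) / ε) := by
    apply arctan_mono; gcongr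
  linarith

lemma exists_polar_sub {ε : ℝ} (hε : 0 < ε) (t b : ℝ) :
    ∃ ρ : ℝ, 0 < ρ ∧
      (⟨t, ε⟩ : ℂ) - (b : ℂ) = ρ * Complex.exp (rootAngle ε t b * Complex.I) := by
  have hs : 0 < √(1 + ((t - b) / ε) ^ 2) := Real.sqrt_pos.2 (by positivity)
  refine ⟨ε * √(1 + ((t - b) / ε) ^ 2), by positivity, ?_⟩
  rw [Complex.exp_mul_I, ← Complex.ofReal_cos, ← Complex.ofReal_sin, rootAngle,
    Real.cos_pi_div_two_sub, Real.sin_pi_div_two_sub, sin_arctan, cos_arctan]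
  apply Complex.ext
  · simp only [Complex.sub_re, Complex.ofReal_re, Complex.mul_re, Complex.ofReal_im,
      Complex.add_re, Complex.I_re, Complex.I_im, Complex.add_im, Complex.mul_im]
    field_simp
    ring
  · simp only [Complex.sub_im, Complex.ofReal_re, Complex.mul_re, Complex.ofReal_im,
      Complex.add_re, Complex.I_re, Complex.I_im, Complex.add_im, Complex.mul_im]
    field_simp
    ring

lemma exists_polar_prod {ε : ℝ} (hε : 0 < ε) (t : ℝ) (l : List ℝ) :
    ∃ ρ : ℝ, 0 < ρ ∧ (l.map fun b : ℝ => (⟨t, ε⟩ : ℂ) - (b : ℂ)).prod =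
      ρ * Complex.exp (angleSum ε t l * Complex.I) := by
  induction l with
  | nil => exact ⟨1, one_pos, by simp [angleSum]⟩
  | cons b l ih =>
    obtain ⟨ρ, hρ, h⟩ := ih
    obtain ⟨σ, hσ, h'⟩ := exists_polar_sub hε t b
    refine ⟨σ * ρ, mul_pos hσ hρ, ?_⟩
    rw [List.map_cons, List.prod_cons, h, h']
    have : angleSum ε t (b :: l) = rootAngle ε t b + angleSum ε t l := by simp [angleSum]
    rw [this]
    push_cast
    rw [add_mul, Complex.exp_add]
    ring

lemma coe_zeros (f : ℝ[X]) : (zeros f : Multiset ℝ) = f.roots := Multiset.sort_eq _ _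

lemma exists_polar_aeval {f : ℝ[X]} (hf : RealRooted f) (hlc : 0 < f.leadingCoeff)
    {ε : ℝ} (hε : 0 < ε) (t : ℝ) :
    ∃ ρ : ℝ, 0 < ρ ∧
      aeval (⟨t, ε⟩ : ℂ) f = ρ * Complex.exp (angleSum ε t (zeros f) * Complex.I) := by
  obtain ⟨ρ, hρ, h⟩ := exists_polar_prod hε t (zeros f)
  refine ⟨f.leadingCoeff * ρ, mul_pos hlc hρ, ?_⟩
  have h1 := Splits.eq_prod_roots hf
  rw [← coe_zeros, Multiset.map_coe, Multiset.prod_coe] at h1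
  conv_lhs => rw [h1]
  rw [map_mul, map_list_prod, List.map_map, aeval_C]
  have : (⇑(aeval (⟨t, ε⟩ : ℂ)) ∘ fun a : ℝ => X - C a) =
      fun b : ℝ => (⟨t, ε⟩ : ℂ) - (b : ℂ) := by
    funext b; simp
  rw [this, h]
  push_cast
  simp [mul_assoc]

lemma exists_polar_mul_conj {f g : ℝ[X]} (hf : RealRooted f) (hg : RealRooted g)
    (hlf : 0 < f.leadingCoeff) (hlg : 0 < g.leadingCoeff) {ε : ℝ} (hε : 0 < ε) (t : ℝ) :
    ∃ ρ : ℝ, 0 < ρ ∧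
      (aeval (⟨t, ε⟩ : ℂ) g * (starRingEnd ℂ) (aeval (⟨t, ε⟩ : ℂ) f)).re =
        ρ * cos (angleSum ε t (zeros g) - angleSum ε t (zeros f)) ∧
      (aeval (⟨t, ε⟩ : ℂ) g * (starRingEnd ℂ) (aeval (⟨t, ε⟩ : ℂ) f)).im =
        ρ * sin (angleSum ε t (zeros g) - angleSum ε t (zeros f)) := by
  obtain ⟨ρ, hρ, h⟩ := exists_polar_aeval hf hlf hε t
  obtain ⟨σ, hσ, h'⟩ := exists_polar_aeval hg hlg hε t
  refine ⟨σ * ρ, mul_pos hσ hρ, ?_⟩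
  rw [h, h', Complex.exp_mul_I, Complex.exp_mul_I]
  simp only [← Complex.ofReal_cos, ← Complex.ofReal_sin, cos_sub, sin_sub]
  constructor <;>
  · simp only [map_mul, map_add, Complex.conj_ofReal, Complex.conj_I, Complex.mul_re,
      Complex.mul_im, Complex.add_re, Complex.add_im, Complex.ofReal_re, Complex.ofReal_im,
      Complex.I_re, Complex.I_im, Complex.neg_re, Complex.neg_im]
    ring

/-! ### Alternating lists -/

/-- Removing the top of the chain exchanges the roles of the two lists. -/
lemma alternates_cons_iff {α β : List ℝ} {b : ℝ} :
    Alternates α (b :: β) ↔ (∀ h : 0 < α.length, α[0] ≤ b) ∧ Alternates β α := by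
  constructor
  · rintro ⟨hl, h1, h2⟩
    refine ⟨fun h => h1 0 h (by simp), ?_, fun i hi hi' => ?_, fun i hi hi' => ?_⟩
    · simp only [List.length_cons] at hl; omega
    · have := h2 i hi' (by simpa using hi)
      rwa [List.getElem_cons_succ] at this
    · have := h1 (i + 1) hi' (by simpa using hi)
      rwa [List.getElem_cons_succ] at this
  · rintro ⟨h0, hl, h1, h2⟩
    refine ⟨?_, fun i hi hi' => ?_, fun i hi hi' => ?_⟩
    · simp only [List.length_cons]; omega
    · cases i with
      | zero => simpa using h0 hi
      | succ i => simpa using h2 i (by simpa using hi') hi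
    · simpa using h1 i (by simpa using hi') hi

/-- The difference is an alternating sum of weakly decreasing nonnegative terms, hence between 0 and
its first term. -/
lemma Alternates.sum_sub_sum_mem {φ : ℝ → ℝ} (hφ : Monotone φ) (hφ0 : ∀ x, 0 ≤ φ x) :
    ∀ (α β : List ℝ), Alternates α β →
      0 ≤ (β.map φ).sum - (α.map φ).sum ∧
        (β.map φ).sum - (α.map φ).sum ≤ ((β.map φ).head?).getD 0
  | α, [], h => by
    have : α = [] := by
      have := h.1
      simp only [List.length_nil] at this
      exact List.length_eq_zero_iff.1 (by omega)
    simp [this]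
  | α, b :: β, h => by
    obtain ⟨h0, h1⟩ := alternates_cons_iff.1 h
    obtain ⟨h2, h3⟩ := Alternates.sum_sub_sum_mem hφ hφ0 β α h1
    have h4 : ((α.map φ).head?).getD 0 ≤ φ b := by
      cases α with
      | nil => simpa using hφ0 b
      | cons a α => exact hφ (h0 (by simp))
    simp only [List.map_cons, List.sum_cons, List.head?_cons, Option.getD_some]
    constructor <;> linarith
  termination_by α β => α.length + β.length

lemma Alternates.angleSum_sub_mem {α β : List ℝ} (h : Alternates α β) {ε : ℝ} (hε : 0 < ε)
    (t : ℝ) :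
    0 ≤ angleSum ε t β - angleSum ε t α ∧ angleSum ε t β - angleSum ε t α < π := by
  obtain ⟨h1, h2⟩ := Alternates.sum_sub_sum_mem (rootAngle_mono hε t)
    (fun x => (rootAngle_pos ε t x).le) α β h
  refine ⟨h1, h2.trans_lt ?_⟩
  cases β with
  | nil => simpa using pi_pos
  | cons b β => simpa using rootAngle_lt_pi ε t b

/-! ### The argument cone -/

/-- `w` is nonzero with argument in `[0, π)`. -/
def InUpperCone (w : ℂ) : Prop := 0 < w.im ∨ (w.im = 0 ∧ 0 < w.re)

lemma InUpperCone.im_nonneg {w : ℂ} (h : InUpperCone w) : 0 ≤ w.im := by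
  rcases h with h | h
  · exact h.le
  · exact h.1.ge

lemma InUpperCone.ne_zero {w : ℂ} (h : InUpperCone w) : w ≠ 0 := by
  rintro rfl
  simp [InUpperCone] at h

lemma InUpperCone.add {w v : ℂ} (hw : InUpperCone w) (hv : v = 0 ∨ InUpperCone v) :
    InUpperCone (w + v) := by
  rcases hv with rfl | hv
  · simpa using hw
  · simp only [InUpperCone, Complex.add_im, Complex.add_re] at *
    rcases hw with hw | hw <;> rcases hv with hv | hv
    · left; linarith
    · left; linarith
    · left; linarith
    · right; constructor <;> linarith

/-- The half-open cone contains no two opposite vectors, so it is closed under addition and omits 0.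
-/
lemma InUpperCone.add_sum {ι : Type*} {w : ℂ} (hw : InUpperCone w) (s : Finset ι) {v : ι → ℂ}
    (hv : ∀ i ∈ s, v i = 0 ∨ InUpperCone (v i)) : InUpperCone (w + ∑ i ∈ s, v i) := by
  classical
  induction s using Finset.induction_on with
  | empty => simpa using hw
  | insert a s ha ih =>
    rw [Finset.sum_insert ha, add_comm (v a), ← add_assoc]
    exact (ih fun i hi => hv i (Finset.mem_insert_of_mem hi)).add
      (hv a (Finset.mem_insert_self _ _))

lemma inUpperCone_mul_conj_self {w : ℂ} (hw : w ≠ 0) :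
    InUpperCone (w * (starRingEnd ℂ) w) := by
  rw [Complex.mul_conj]
  exact Or.inr ⟨Complex.ofReal_im _, by simpa using hw⟩

lemma Interleaves.mul_conj {f g : ℝ[X]} (h : Interleaves f g) {z : ℂ} (hz : 0 < z.im) :
    aeval z g * (starRingEnd ℂ) (aeval z f) = 0 ∨
      InUpperCone (aeval z g * (starRingEnd ℂ) (aeval z f)) := by
  rcases h with rfl | rfl | ⟨hf, hg, hlf, hlg, hfg⟩
  · simp
  · simp
  · right
    obtain ⟨ρ, hρ, hre, him⟩ := exists_polar_mul_conj hf hg hlf hlg hz z.re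
    obtain ⟨h0, h1⟩ := hfg.angleSum_sub_mem hz z.re
    rw [InUpperCone]
    rw [hre, him]
    rcases h0.eq_or_lt with h0 | h0
    · right; simp [← h0, hρ]
    · left; exact mul_pos hρ (sin_pos_of_pos_of_lt_pi h0 h1)

lemma Interleaves.im_mul_conj_nonneg {f g : ℝ[X]} (h : Interleaves f g) {z : ℂ}
    (hz : 0 < z.im) : 0 ≤ (aeval z g * (starRingEnd ℂ) (aeval z f)).im := by
  rcases h.mul_conj hz with h | h
  · rw [h]; simp
  · exact h.im_nonneg

/-! ### Real-rootedness from the absence of zeros in the upper half-plane -/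

lemma realRooted_of_forall_im_pos {f : ℝ[X]} (h : ∀ z : ℂ, 0 < z.im → aeval z f ≠ 0) :
    RealRooted f := by
  induction hn : f.natDegree generalizing f with
  | zero => exact Splits.of_natDegree_eq_zero hn
  | succ n ih =>
    have hf0 : f ≠ 0 := by rintro rfl; simp at hn
    obtain ⟨z, hz⟩ := IsAlgClosed.exists_aeval_eq_zero ℂ f fun hd => by
      have := natDegree_eq_zero_iff_degree_le_zero.2 hd.le
      omega
    have him : z.im = 0 := by
      rcases lt_trichotomy z.im 0 with h1 | h1 | h1
      · refine absurd ?_ (h ((starRingEnd ℂ) z) (by simpa using h1))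
        rw [aeval_conj, hz, map_zero]
      · exact h1
      · exact absurd hz (h z h1)
    have hz' : z = algebraMap ℝ ℂ z.re := Complex.ext rfl him
    have hroot : f.IsRoot z.re := by
      rw [hz', aeval_algebraMap_apply] at hz
      exact (FaithfulSMul.algebraMap_injective ℝ ℂ) (by simpa using hz)
    obtain ⟨q, rfl⟩ := dvd_iff_isRoot.2 hroot
    have hq0 : q ≠ 0 := right_ne_zero_of_mul hf0
    refine (Splits.X_sub_C _).mul (ih (fun w hw hw0 => h w hw (by simp [hw0])) ?_)
    rw [natDegree_mul (X_sub_C_ne_zero _) hq0, natDegree_X_sub_C] at hn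
    omega

/-! ### Multiplication by `X` -/

lemma nonpos_of_mem_zeros {f : ℝ[X]} (hf : f ≠ 0) (hc : ∀ k, 0 ≤ f.coeff k) {r : ℝ}
    (hr : r ∈ zeros f) : r ≤ 0 := by
  by_contra! h
  have hr' : r ∈ f.roots := by rw [← coe_zeros]; exact hr
  have he : f.eval r = 0 := (mem_roots hf).1 hr'
  rw [eval_eq_sum_range] at he
  have h1 : f.coeff f.natDegree * r ^ f.natDegree ≤ 0 := by
    rw [← he]
    exact Finset.single_le_sum (f := fun i => f.coeff i * r ^ i)
      (fun i _ => mul_nonneg (hc i) (pow_pos h i).le) (by simp)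
  have h2 : 0 < f.coeff f.natDegree :=
    lt_of_le_of_ne (hc _) (Ne.symm (leadingCoeff_ne_zero.2 hf))
  have := mul_pos h2 (pow_pos h f.natDegree)
  linarith

lemma zeros_X_mul {f : ℝ[X]} (hf : f ≠ 0) (hc : ∀ k, 0 ≤ f.coeff k) :
    zeros (X * f) = 0 :: zeros f := by
  rw [zeros, roots_mul (mul_ne_zero X_ne_zero hf), roots_X, Multiset.singleton_add,
    Multiset.sort_cons, zeros]
  intro b hb
  exact nonpos_of_mem_zeros hf hc (by rw [← coe_zeros] at hb; exact hb)

/-- All zeros are nonpositive, so the new zero 0 goes on top of the chain. -/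
lemma Interleaves.X_mul_right {f g : ℝ[X]} (h : Interleaves f g) (hf : ∀ k, 0 ≤ f.coeff k)
    (hg : ∀ k, 0 ≤ g.coeff k) : Interleaves g (X * f) := by
  by_cases hf0 : f = 0
  · simp [Interleaves, hf0]
  by_cases hg0 : g = 0
  · simp [Interleaves, hg0]
  obtain ⟨hrf, hrg, hlf, hlg, hfg⟩ := (h.resolve_left hf0).resolve_left hg0
  refine Or.inr (Or.inr ⟨hrg, splits_X_mul.2 hrf, hlg, by simpa using hlf, ?_⟩)
  rw [zeros_X_mul hf0 hf, alternates_cons_iff]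
  exact ⟨fun h => nonpos_of_mem_zeros hg0 hg (List.getElem_mem _), hfg⟩

/-! ### Counting zeros by the argument -/

lemma tendsto_rootAngle_atTop {ε : ℝ} (hε : 0 < ε) (b : ℝ) :
    Tendsto (fun t => rootAngle ε t b) atTop (𝓝 0) := by
  have h1 : Tendsto (fun t : ℝ => (t - b) / ε) atTop atTop :=
    (tendsto_atTop_add_const_right _ (-b) tendsto_id).atTop_div_const hε
  have h2 := (tendsto_nhds_of_tendsto_nhdsWithin tendsto_arctan_atTop).comp h1
  simpa [rootAngle] using h2.const_sub (π / 2)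

lemma tendsto_angleSum_atTop {ε : ℝ} (hε : 0 < ε) (l : List ℝ) :
    Tendsto (fun t => angleSum ε t l) atTop (𝓝 0) := by
  induction l with
  | nil => simp [angleSum]
  | cons b l ih => simpa [angleSum] using (tendsto_rootAngle_atTop hε b).add ih

lemma continuous_angleSum (ε : ℝ) (l : List ℝ) : Continuous fun t => angleSum ε t l := by
  induction l with
  | nil => simpa [angleSum] using continuous_const
  | cons b l ih =>
    have : Continuous fun t => rootAngle ε t b :=
      continuous_const.sub (continuous_arctan.comp (by fun_prop))
    simp only [angleSum, List.map_cons, List.sum_cons] at ih ⊢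
    exact this.add ih

lemma tendsto_rootAngle_zero_of_lt {t b : ℝ} (h : b < t) :
    Tendsto (fun ε => rootAngle ε t b) (𝓝[>] 0) (𝓝 0) := by
  have h1 : Tendsto (fun ε : ℝ => (t - b) / ε) (𝓝[>] 0) atTop := by
    simpa [div_eq_mul_inv] using tendsto_inv_nhdsGT_zero.const_mul_atTop (sub_pos.2 h)
  have h2 := (tendsto_nhds_of_tendsto_nhdsWithin tendsto_arctan_atTop).comp h1
  simpa [rootAngle] using h2.const_sub (π / 2)

lemma tendsto_rootAngle_zero_of_gt {t b : ℝ} (h : t < b) :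
    Tendsto (fun ε => rootAngle ε t b) (𝓝[>] 0) (𝓝 π) := by
  have h1 : Tendsto (fun ε : ℝ => (t - b) / ε) (𝓝[>] 0) atBot := by
    simpa [div_eq_mul_inv] using
      tendsto_inv_nhdsGT_zero.const_mul_atTop_of_neg (sub_neg.2 h)
  have h2 := (tendsto_nhds_of_tendsto_nhdsWithin tendsto_arctan_atBot).comp h1
  have h3 := h2.const_sub (π / 2)
  simpa [rootAngle] using h3

lemma tendsto_angleSum_zero {t : ℝ} (l : List ℝ) (ht : t ∉ l) :
    Tendsto (fun ε => angleSum ε t l) (𝓝[>] 0) (𝓝 (π * l.countP (t < ·))) := by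
  induction l with
  | nil => simp [angleSum]
  | cons b l ih =>
    simp only [List.mem_cons, not_or] at ht
    rcases lt_or_gt_of_ne ht.1 with h | h
    · have := (tendsto_rootAngle_zero_of_gt h).add (ih ht.2)
      rw [List.countP_cons_of_pos (by simpa using h)]
      push_cast
      rw [mul_add, mul_one, add_comm _ π]
      simpa [angleSum] using this
    · have := (tendsto_rootAngle_zero_of_lt h).add (ih ht.2)
      rw [List.countP_cons_of_neg (by simpa using h.le)]
      simpa [angleSum] using this

/-- The sign of the sine locates an angle only modulo 2π; continuity and the limit 0 fix the branch.
-/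
lemma mem_Icc_of_sin_nonneg {Θ : ℝ → ℝ} (hc : Continuous Θ) (h0 : Tendsto Θ atTop (𝓝 0))
    (hs : ∀ t, 0 ≤ sin (Θ t)) (t : ℝ) : Θ t ∈ Set.Icc 0 π := by
  have hπ := pi_pos
  constructor
  · by_contra! h
    -- Truncation gives a value in `(-π, 0)`, where the sine is negative, that `Θ` attains.
    set c := max (Θ t) (-(π / 2)) with hcdef
    have hc0 : c < 0 := max_lt h (by linarith)
    have hcπ : -π < c := lt_of_lt_of_le (by linarith) (le_max_right _ _)
    obtain ⟨s, hs1⟩ := (h0.eventually (lt_mem_nhds hc0)).exists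
    obtain ⟨u, hu⟩ := mem_range_of_exists_le_of_exists_ge hc ⟨t, le_max_left _ _⟩ ⟨s, hs1.le⟩
    have := hs u
    rw [hu] at this
    linarith [sin_neg_of_neg_of_neg_pi_lt hc0 hcπ]
  · by_contra! h
    set c := min (Θ t) (3 * π / 2) with hcdef
    have hc0 : π < c := lt_min h (by linarith)
    have hcπ : c < 2 * π := lt_of_le_of_lt (min_le_right _ _) (by linarith)
    obtain ⟨s, hs1⟩ := (h0.eventually (gt_mem_nhds (hπ.trans hc0))).exists
    obtain ⟨u, hu⟩ := mem_range_of_exists_le_of_exists_ge hc ⟨s, hs1.le⟩ ⟨t, min_le_left _ _⟩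
    have := hs u
    rw [hu] at this
    have h2 : sin (c - π) = -sin c := sin_sub_pi c
    linarith [sin_pos_of_pos_of_lt_pi (x := c - π) (by linarith) (by linarith)]

/-- As `ε → 0⁺` the angle sum tends to π times the number of zeros above `t`, so an angle difference
in `[0, π]` becomes a count difference in `[0, 1]`. -/
lemma countP_zeros_le {f g : ℝ[X]} (hf : RealRooted f) (hg : RealRooted g)
    (hlf : 0 < f.leadingCoeff) (hlg : 0 < g.leadingCoeff)
    (h : ∀ z : ℂ, 0 < z.im → 0 ≤ (aeval z g * (starRingEnd ℂ) (aeval z f)).im)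
    {t : ℝ} (htf : t ∉ zeros f) (htg : t ∉ zeros g) :
    (zeros f).countP (t < ·) ≤ (zeros g).countP (t < ·) ∧
      (zeros g).countP (t < ·) ≤ (zeros f).countP (t < ·) + 1 := by
  have key : ∀ ε : ℝ, 0 < ε →
      angleSum ε t (zeros g) - angleSum ε t (zeros f) ∈ Set.Icc 0 π := by
    intro ε hε
    refine mem_Icc_of_sin_nonneg
      (Θ := fun t => angleSum ε t (zeros g) - angleSum ε t (zeros f))
      ((continuous_angleSum ε _).sub (continuous_angleSum ε _))
      ?_ (fun s => ?_) t
    · simpa using (tendsto_angleSum_atTop hε (zeros g)).sub (tendsto_angleSum_atTop hε (zeros f))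
    obtain ⟨ρ, hρ, -, him⟩ := exists_polar_mul_conj hf hg hlf hlg hε s
    have := h ⟨s, ε⟩ hε
    rw [him] at this
    exact nonneg_of_mul_nonneg_right this hρ
  have hlim := (tendsto_angleSum_zero _ htg).sub (tendsto_angleSum_zero _ htf)
  have hmem := isClosed_Icc.mem_of_tendsto hlim
    (eventually_nhdsWithin_of_forall fun ε hε => key ε hε)
  obtain ⟨h1, h2⟩ := hmem
  rw [← mul_sub] at h1 h2
  have h3 := nonneg_of_mul_nonneg_right h1 pi_pos
  have h4 := le_of_mul_le_mul_left (h2.trans_eq (mul_one π).symm) pi_pos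
  constructor
  · exact_mod_cast sub_nonneg.1 h3
  · have : ((zeros g).countP (t < ·) : ℝ) ≤ (zeros f).countP (t < ·) + 1 := by linarith
    exact_mod_cast this

/-! ### Recovering alternation from counting functions. -/

lemma succ_le_countP {l : List ℝ} (hl : l.Pairwise (· ≥ ·)) {i : ℕ} (hi : i < l.length) {t : ℝ}
    (ht : t < l[i]) : i + 1 ≤ l.countP (t < ·) := by
  have h1 : (l.take (i + 1)).countP (t < ·) = (l.take (i + 1)).length := by
    rw [List.countP_eq_length]
    intro a ha
    obtain ⟨j, hj, rfl⟩ := List.mem_iff_getElem.1 ha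
    rw [List.length_take] at hj
    rw [List.getElem_take]
    refine decide_eq_true (ht.trans_le ?_)
    rcases (show j ≤ i by omega).eq_or_lt with rfl | hji
    · exact le_rfl
    · exact List.pairwise_iff_getElem.1 hl j i _ hi hji
  have h2 := (List.take_sublist (i + 1) l).countP_le (p := (t < ·))
  rw [h1, List.length_take] at h2
  omega

lemma countP_le_of_getElem_le {l : List ℝ} (hl : l.Pairwise (· ≥ ·)) {i : ℕ}
    (hi : i < l.length) {t : ℝ} (ht : l[i] ≤ t) : l.countP (t < ·) ≤ i := by
  have h1 : (l.drop i).countP (t < ·) = 0 := by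
    rw [List.countP_eq_zero]
    intro a ha
    obtain ⟨j, hj, rfl⟩ := List.mem_iff_getElem.1 ha
    rw [List.length_drop] at hj
    rw [List.getElem_drop]
    have : l[i + j] ≤ l[i] := by
      rcases Nat.eq_zero_or_pos j with rfl | hj0
      · exact le_rfl
      · exact List.pairwise_iff_getElem.1 hl i (i + j) hi (by omega) (by omega)
    simpa using this.trans ht
  rw [← List.take_append_drop i l, List.countP_append, h1, add_zero]
  exact List.countP_le_length.trans (by simp)

lemma alternates_of_countP {α β : List ℝ} (hα : α.Pairwise (· ≥ ·)) (hβ : β.Pairwise (· ≥ ·))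
    (h : ∀ t, t ∉ α → t ∉ β →
      α.countP (t < ·) ≤ β.countP (t < ·) ∧ β.countP (t < ·) ≤ α.countP (t < ·) + 1) :
    Alternates α β := by
  have hsep : ∀ a b : ℝ, a < b → ∃ t, a < t ∧ t < b ∧ t ∉ α ∧ t ∉ β := by
    intro a b hab
    obtain ⟨t, ht, ht'⟩ := (Set.Ioo_infinite hab).exists_notMem_finset (α ++ β).toFinset
    simp only [List.mem_toFinset, List.mem_append, not_or] at ht'
    exact ⟨t, ht.1, ht.2, ht'⟩
  refine ⟨?_, fun i hi hi' => ?_, fun i hi hi' => ?_⟩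
  -- Below all entries the counts are the lengths.
  · obtain ⟨t, ht⟩ : ∃ t, ∀ x ∈ (α ++ β).toFinset, t < x := by
      obtain ⟨u, hu⟩ := (α ++ β).toFinset.bddBelow
      exact ⟨u - 1, fun x hx => by linarith [hu hx]⟩
    have hα' : ∀ x ∈ α, t < x := fun x hx => ht x (by simp [hx])
    have hβ' : ∀ x ∈ β, t < x := fun x hx => ht x (by simp [hx])
    have := h t (fun hx => lt_irrefl _ (hα' t hx)) (fun hx => lt_irrefl _ (hβ' t hx))
    rw [List.countP_eq_length.2 (by simpa using hα'),
      List.countP_eq_length.2 (by simpa using hβ')] at this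
    omega
  · by_contra! hlt
    obtain ⟨t, h1, h2, h3, h4⟩ := hsep _ _ hlt
    have := h t h3 h4
    have := succ_le_countP hα hi h2
    have := countP_le_of_getElem_le hβ hi' h1.le
    omega
  · by_contra! hlt
    obtain ⟨t, h1, h2, h3, h4⟩ := hsep _ _ hlt
    have := h t h3 h4
    have := succ_le_countP hβ hi' h2
    have := countP_le_of_getElem_le hα hi h1.le
    omega

lemma leadingCoeff_pos {f : ℝ[X]} (hf : f ≠ 0) (hc : ∀ k, 0 ≤ f.coeff k) :
    0 < f.leadingCoeff :=
  lt_of_le_of_ne (hc _) (Ne.symm (leadingCoeff_ne_zero.2 hf))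

lemma interleaves_of_im_nonneg {f g : ℝ[X]} (hf : RealRooted f) (hg : RealRooted g)
    (hcf : ∀ k, 0 ≤ f.coeff k) (hcg : ∀ k, 0 ≤ g.coeff k)
    (h : ∀ z : ℂ, 0 < z.im → 0 ≤ (aeval z g * (starRingEnd ℂ) (aeval z f)).im) :
    Interleaves f g := by
  by_cases hf0 : f = 0
  · exact Or.inl hf0
  by_cases hg0 : g = 0
  · exact Or.inr (Or.inl hg0)
  have hlf := leadingCoeff_pos hf0 hcf
  have hlg := leadingCoeff_pos hg0 hcg
  exact Or.inr (Or.inr ⟨hf, hg, hlf, hlg, alternates_of_countP (Multiset.pairwise_sort _ _)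
    (Multiset.pairwise_sort _ _) fun t htf htg => countP_zeros_le hf hg hlf hlg h htf htg⟩)

/-! ### Matrices with entries in `{0, 1, X}` -/

lemma im_sum_mul_conj_sum_nonneg {ι : Type*} (s t : Finset ι) (u v : ι → ℂ)
    (h : ∀ i ∈ s, ∀ j ∈ t, 0 ≤ (v j * (starRingEnd ℂ) (u i)).im) :
    0 ≤ ((∑ j ∈ t, v j) * (starRingEnd ℂ) (∑ i ∈ s, u i)).im := by
  rw [map_sum, Finset.sum_mul_sum, Complex.im_sum]
  refine Finset.sum_nonneg fun j hj => ?_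
  rw [Complex.im_sum]
  exact Finset.sum_nonneg fun i hi => h i hi j hj

lemma sum_ne_zero_of_mul_conj {ι : Type*} [Fintype ι] {t : ι → ℂ} {b : ι} (hb : t b ≠ 0)
    (h : ∀ i, i ≠ b →
      t i * (starRingEnd ℂ) (t b) = 0 ∨ InUpperCone (t i * (starRingEnd ℂ) (t b))) :
    ∑ i, t i ≠ 0 := by
  classical
  have h1 := (inUpperCone_mul_conj_self hb).add_sum (Finset.univ.erase b)
    (v := fun i => t i * (starRingEnd ℂ) (t b)) fun i hi => h i (Finset.ne_of_mem_erase hi)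
  rw [Finset.add_sum_erase _ (fun i => t i * (starRingEnd ℂ) (t b)) (Finset.mem_univ b),
    ← Finset.sum_mul] at h1
  exact left_ne_zero_of_mul h1.ne_zero

lemma RealRooted.aeval_ne_zero {f : ℝ[X]} (hf : RealRooted f) (hf0 : f ≠ 0)
    (hc : ∀ k, 0 ≤ f.coeff k) {z : ℂ} (hz : 0 < z.im) : aeval z f ≠ 0 := by
  obtain ⟨ρ, hρ, h⟩ := exists_polar_aeval hf (leadingCoeff_pos hf0 hc) hz z.re
  have h' : aeval z f = _ := h
  rw [h']
  exact mul_ne_zero (by exact_mod_cast hρ.ne') (Complex.exp_ne_zero _)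

lemma mul_conj_mul_left {z w v : ℂ} (hz : z ≠ 0)
    (h : w * (starRingEnd ℂ) v = 0 ∨ InUpperCone (w * (starRingEnd ℂ) v)) :
    z * w * (starRingEnd ℂ) (z * v) = 0 ∨ InUpperCone (z * w * (starRingEnd ℂ) (z * v)) := by
  have h1 : z * w * (starRingEnd ℂ) (z * v) =
      (Complex.normSq z : ℂ) * (w * (starRingEnd ℂ) v) := by
    rw [map_mul, ← Complex.mul_conj]; ring
  have h2 : 0 < Complex.normSq z := Complex.normSq_pos.2 hz
  rw [h1]
  rcases h with h | h
  · simp [h]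
  · right
    simp only [InUpperCone, Complex.im_ofReal_mul, Complex.re_ofReal_mul] at h ⊢
    rcases h with h | h
    · exact Or.inl (mul_pos h2 h)
    · exact Or.inr ⟨by rw [h.1, mul_zero], mul_pos h2 h.2⟩

lemma coeff_sum_mul_nonneg {n : ℕ} {f r : Fin n → ℝ[X]} (hf : ∀ i k, 0 ≤ (f i).coeff k)
    (hr : ∀ i, r i = 0 ∨ r i = 1 ∨ r i = X) (k : ℕ) : 0 ≤ (∑ i, r i * f i).coeff k := by
  rw [finsetSum_coeff]
  refine Finset.sum_nonneg fun i _ => ?_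
  rcases hr i with h | h | h
  · simp [h]
  · simpa [h] using hf i k
  · cases k with
    | zero => simp [h]
    | succ k => simpa [h, coeff_X_mul] using hf i k

lemma realRooted_sum_mul {n : ℕ} {f r : Fin n → ℝ[X]} (hf : f ∈ nonnegInterlacingFamily n)
    (hr : ∀ i, r i = 0 ∨ r i = 1 ∨ r i = X) (hlt : ∀ i j, r i = X → r j = 1 → i < j) :
    RealRooted (∑ i, r i * f i) := by
  obtain ⟨⟨hrr, hint⟩, hc⟩ := hf
  have hmin : ∀ P : Fin n → Prop, (∃ i, P i) → ∃ b, P b ∧ ∀ i, P i → b ≤ i := by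
    classical
    rintro P ⟨i, hi⟩
    have hne : (Finset.univ.filter P).Nonempty := ⟨i, by simpa using hi⟩
    refine ⟨_, (Finset.mem_filter.1 (Finset.min'_mem _ hne)).2, fun j hj => ?_⟩
    exact Finset.min'_le _ _ (by simpa using hj)
  by_cases h1 : ∃ i, r i = 1 ∧ f i ≠ 0
  -- The reference term is the leftmost nonzero `f b` with entry 1: later such terms follow it in
  -- `≪`, and so does `X * f i` for the earlier columns with entry `X`.
  · obtain ⟨b, ⟨hb1, hb0⟩, hb⟩ := hmin _ h1
    refine realRooted_of_forall_im_pos fun z hz => ?_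
    rw [map_sum]
    refine sum_ne_zero_of_mul_conj (b := b) ?_ fun i hi => ?_
    · simpa [hb1] using (hrr b).aeval_ne_zero hb0 (hc b) hz
    · rw [hb1, one_mul]
      rcases hr i with h | h | h
      · simp [h]
      · by_cases hi0 : f i = 0
        · simp [hi0]
        · rw [h, one_mul]
          exact (hint b i (lt_of_le_of_ne (hb i ⟨h, hi0⟩) hi.symm)).mul_conj hz
      · rw [h]
        exact ((hint i b (hlt i b h hb1)).X_mul_right (hc i) (hc b)).mul_conj hz
  by_cases h2 : ∃ i, r i = X ∧ f i ≠ 0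
  -- Only entries `X` contribute here; the common factor `z` scales the products by `|z|²`.
  · obtain ⟨b, ⟨hbX, hb0⟩, hb⟩ := hmin _ h2
    refine realRooted_of_forall_im_pos fun z hz => ?_
    have hz0 : z ≠ 0 := by rintro rfl; simp at hz
    rw [map_sum]
    refine sum_ne_zero_of_mul_conj (b := b) ?_ fun i hi => ?_
    · simpa [hbX, hz0] using (hrr b).aeval_ne_zero hb0 (hc b) hz
    · by_cases hi0 : f i = 0
      · simp [hi0]
      rcases hr i with h | h | h
      · simp [h]
      · exact absurd ⟨i, h, hi0⟩ h1
      · rw [hbX, h, map_mul, map_mul, aeval_X]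
        exact mul_conj_mul_left hz0
          ((hint b i (lt_of_le_of_ne (hb i ⟨h, hi0⟩) hi.symm)).mul_conj hz)
  · have : ∑ i, r i * f i = 0 := by
      refine Finset.sum_eq_zero fun i _ => ?_
      by_cases hi0 : f i = 0
      · simp [hi0]
      rcases hr i with h | h | h
      · simp [h]
      · exact absurd ⟨i, h, hi0⟩ h1
      · exact absurd ⟨i, h, hi0⟩ h2
    rw [this]
    exact Splits.zero

/-- Of the sixteen products, those of `v` and of `z * l` with their own conjugates are real, and the
two mixed `v`, `z * l` products are conjugate, so their imaginary parts cancel. The rest are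
nonnegative. -/
lemma im_block_sum_nonneg {z l d m r v : ℂ} (hz : 0 < z.im)
    (hmr : 0 ≤ (z * m * (starRingEnd ℂ) r).im) (hmv : 0 ≤ (z * m * (starRingEnd ℂ) v).im)
    (hlm : 0 ≤ (m * (starRingEnd ℂ) l).im) (hdm : 0 ≤ (z * d * (starRingEnd ℂ) m).im)
    (hdr : 0 ≤ (z * d * (starRingEnd ℂ) r).im) (hdv : 0 ≤ (z * d * (starRingEnd ℂ) v).im)
    (hld : 0 ≤ (d * (starRingEnd ℂ) l).im) (hmv' : 0 ≤ (v * (starRingEnd ℂ) m).im)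
    (hrv : 0 ≤ (v * (starRingEnd ℂ) r).im) (hlm' : 0 ≤ (z * l * (starRingEnd ℂ) m).im)
    (hlr : 0 ≤ (z * l * (starRingEnd ℂ) r).im) :
    0 ≤ ((z * m + z * d + v + z * l) * (starRingEnd ℂ) (m + r + v + z * l)).im := by
  have hn := Complex.normSq_nonneg z
  have h1 := mul_nonneg hn hlm
  have h2 := mul_nonneg hn hld
  have h3 := mul_nonneg hz.le (Complex.normSq_nonneg m)
  simp only [map_add, map_mul, Complex.normSq_apply, Complex.mul_im, Complex.mul_re,
    Complex.add_im, Complex.add_re, Complex.conj_re, Complex.conj_im] at *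
  linarith

theorem preservesInterlacing_of_ferrers (m n : ℕ) (G : Matrix (Fin m) (Fin n) ℝ[X])
    (hG : ∀ i j, G i j = 0 ∨ G i j = 1 ∨ G i j = X)
    (h_one : ∀ i j, G i j = 1 → ∀ k l, k ≤ i → j ≤ l → G k l = 1)
    (h_X : ∀ i j, G i j = X → ∀ k l, i ≤ k → l ≤ j → G k l = X) :
    PreservesInterlacing G := by
  classical
  have h01 : (0 : ℝ[X]) ≠ 1 := zero_ne_one
  have h0X : (0 : ℝ[X]) ≠ X := X_ne_zero.symm
  have h1X : (1 : ℝ[X]) ≠ X := fun h => by simpa using congrArg (eval 0) h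
  have hX1 : ∀ k i j, G k i = X → G k j = 1 → i < j := fun k i j hi hj => by
    by_contra! hji
    exact h1X ((h_one k j hj k i le_rfl hji).symm.trans hi)
  have hX0 : ∀ k i j, G k i = X → G k j = 0 → i < j := fun k i j hi hj => by
    by_contra! hji
    exact h0X (hj.symm.trans (h_X k i hi k j le_rfl hji))
  have h0lt1 : ∀ k i j, G k i = 0 → G k j = 1 → i < j := fun k i j hi hj => by
    by_contra! hji
    exact h01 (hi.symm.trans (h_one k j hj k i le_rfl hji))
  intro f hf
  have hrow : ∀ k, G.mulVec f k = ∑ i, G k i * f i := fun k => rfl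
  have hRR : ∀ k, RealRooted (G.mulVec f k) := fun k => by
    rw [hrow]; exact realRooted_sum_mul hf (hG k) (hX1 k)
  have hcoeff : ∀ k j, 0 ≤ (G.mulVec f k).coeff j := fun k => by
    rw [hrow]; exact coeff_sum_mul_nonneg hf.2 (hG k)
  refine ⟨⟨hRR, fun k l hkl => ?_⟩, hcoeff⟩
  refine interleaves_of_im_nonneg (hRR k) (hRR l) (hcoeff k) (hcoeff l) fun z hz => ?_
  have hone := fun i (h : G l i = 1) => h_one l i h k i hkl.le le_rfl
  have hX := fun i (h : G k i = X) => h_X k i h l i hkl.le le_rfl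
  let S : ℝ[X] → ℝ[X] → ℂ := fun a b =>
    ∑ i with G k i = a ∧ G l i = b, aeval z (f i)
  -- The Ferrers conditions leave only these blocks, `S 0 X` and the irrelevant `S 0 0`; from left
  -- to right the relevant ones are `S X X`, `S 0 X`, `S 1 X`, `S 1 0`, `S 1 1`.
  have hk : aeval z (G.mulVec f k) = S 1 X + S 1 0 + S 1 1 + z * S X X := by
    rw [hrow, map_sum]
    simp only [S, Finset.sum_filter, Finset.mul_sum, ← Finset.sum_add_distrib]
    refine Finset.sum_congr rfl fun i _ => ?_
    rcases hG k i with h | h | h <;> rcases hG l i with h' | h' | h' <;>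
      simp_all [h1X.symm, h0X.symm]
  have hl : aeval z (G.mulVec f l) = z * S 1 X + z * S 0 X + S 1 1 + z * S X X := by
    rw [hrow, map_sum]
    simp only [S, Finset.sum_filter, Finset.mul_sum, ← Finset.sum_add_distrib]
    refine Finset.sum_congr rfl fun i _ => ?_
    rcases hG k i with h | h | h <;> rcases hG l i with h' | h' | h' <;>
      simp_all [h1X.symm, h0X.symm]
  have hfwd : ∀ a b c d, (∀ i j, G k i = a ∧ G l i = b → G k j = c ∧ G l j = d → i < j) →
      0 ≤ (S c d * (starRingEnd ℂ) (S a b)).im := fun a b c d h =>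
    im_sum_mul_conj_sum_nonneg _ _ _ _ fun i hi j hj =>
      (hf.1.2 i j (h i j (Finset.mem_filter.1 hi).2
        (Finset.mem_filter.1 hj).2)).im_mul_conj_nonneg hz
  have hbwd : ∀ a b c d, (∀ i j, G k i = a ∧ G l i = b → G k j = c ∧ G l j = d → i < j) →
      0 ≤ (z * S a b * (starRingEnd ℂ) (S c d)).im := fun a b c d h => by
    simp only [S, Finset.mul_sum]
    refine im_sum_mul_conj_sum_nonneg _ _ _ _ fun j hj i hi => ?_
    have := ((hf.1.2 i j (h i j (Finset.mem_filter.1 hi).2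
      (Finset.mem_filter.1 hj).2)).X_mul_right (hf.2 i) (hf.2 j)).im_mul_conj_nonneg hz
    simpa using this
  rw [hk, hl]
  exact im_block_sum_nonneg hz
    (hbwd _ _ _ _ fun i j hi hj => hX0 l i j hi.2 hj.2)
    (hbwd _ _ _ _ fun i j hi hj => hX1 l i j hi.2 hj.2)
    (hfwd _ _ _ _ fun i j hi hj => hX1 k i j hi.1 hj.1)
    (hbwd _ _ _ _ fun i j hi hj => h0lt1 k i j hi.1 hj.1)
    (hbwd _ _ _ _ fun i j hi hj => h0lt1 k i j hi.1 hj.1)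
    (hbwd _ _ _ _ fun i j hi hj => h0lt1 k i j hi.1 hj.1)
    (hfwd _ _ _ _ fun i j hi hj => hX0 k i j hi.1 hj.1)
    (hfwd _ _ _ _ fun i j hi hj => hX1 l i j hi.2 hj.2)
    (hfwd _ _ _ _ fun i j hi hj => h0lt1 l i j hi.2 hj.2)
    (hbwd _ _ _ _ fun i j hi hj => hX1 k i j hi.1 hj.1)
    (hbwd _ _ _ _ fun i j hi hj => hX1 k i j hi.1 hj.1)

end InterlacingPolynomials

theorem corollary3p5 (m n : ℕ) (G : Matrix (Fin m) (Fin n) (Polynomial ℝ))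
    (hG : ∀ i j, G i j = 0 ∨ G i j = 1 ∨ G i j = Polynomial.X)
    (h_one : ∀ i j, G i j = 1 → ∀ k l, k ≤ i → j ≤ l → G k l = 1)
    (h_X : ∀ i j, G i j = Polynomial.X → ∀ k l, i ≤ k → l ≤ j → G k l = Polynomial.X) :
    InterlacingPolynomials.PreservesInterlacing G :=
  InterlacingPolynomials.preservesInterlacing_of_ferrers m n G hG h_one h_X
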